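/- **Setting.** Let $G$ be a group with a finite symmetric generating set $S\subseteq G\setminus\{e\}$, and let $\mathrm{Cay}(G,S)$ be its left Cayley graph ($x\sim y$ iff $y=sx$ for some $s\in S$; the edge $(x,sx)$ has label $s$), with balls $B_S(g,R)$ for the path distance. Let $\mathcal X$ be a compact metric space and let $G$ act on $\mathcal X^G$ by $(h.\omega)_g=\omega_{gh}$. A $G$-process $(G,\mathcal X,\mu)$ is given by a Borel probability measure $\mu$ on $\mathcal X^G$ that is invariant under this action. **Models.** A sofic approximation $(V_n,\sigma_n)$ consists of finite sets $V_n$ and maps $\sigma_n:G\to\mathrm{Sym}(V_n)$ such that $|\{v\in V_n:\sigma_n^g\sigma_n^h(v)=\sigma_n^{gh}(v)\}|/|V_n|\to1$ for all $g,h\in G$ and $|\{v\in V_n:\sigma_n^g(v)\ne v\}|/|V_n|\to1$ for all $g\neq e$. For $\rho\in\mathcal X^{V_n}$ and $v\in V_n$ put $\Pi_v^{\sigma_n}(\rho)=(\rho_{\sigma_n^g(v)})_{g\in G}\in\mathcal X^G$ and $P_\rho^{\sigma_n}=\frac1{|V_n|}\sum_{v\in V_n}\delta_{\Pi_v^{\sigma_n}(\rho)}$.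 Given Borel probability measures $\mu_n$ on $\mathcal X^{V_n}$, $(V_n,\sigma_n,\mu_n)$ is an *ergodically sofic model* for $(G,\mathcal X,\mu)$ if $(V_n,\sigma_n)$ is a sofic approximation and, for every weak$^*$-open neighbourhood $\mathcal O$ of $\mu$, both $|\{v\in V_n:(\Pi_v^{\sigma_n})_*\mu_n\in\mathcal O\}|/|V_n|\to1$ and $\mu_n(\{\rho:P_\rho^{\sigma_n}\in\mathcal O\})\to1$. **Graphs.** Let $E_n$ be the graph on $V_n$ with edges $(v,\sigma_n^s(v))$, $s\in S$, labelled by $s$ (made symmetric, without loops). A vertex $v\in V_n$ is *$R$-good* if the ball $B_{E_n}(v,R)$ is isomorphic, as an edge-labelled graph, to $B_S(e,R)$ by an isomorphism that takes $v$ to $e$ and under which $g\in B_S(e,R)$ corresponds to $\sigma_n^g(v)$. **Operators.** For a bounded operator $H$ on $\ell^2(V)$ write $H(x,y)=\langle\delta_x,H\delta_y\rangle$; a number $M\in\mathbb N$ is a *hopping range parameter* if $H(x,y)=0$ whenever the path distance of $x$ and $y$ exceeds $M$. A *continuous operator over $\mathrm{Cay}(G,S)$ with parameter $M$* is a family $\{H^\omega\}_{\omega\in\mathcal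 X^G}$ of bounded self-adjoint operators on $\ell^2(G)$ such that all maps $\omega\mapsto H^\omega(x,y)$ are continuous, $M$ is a hopping range parameter of every $H^\omega$, and $H^\omega(xg,yg)=H^{g.\omega}(x,y)$ for all $x,y,g,\omega$. It is of *bounded interaction* if for some $K\in\mathbb N$, $\omega_1|_{B_S(e,K)}=\omega_2|_{B_S(e,K)}$ implies $H^{\omega_1}(e,x)=H^{\omega_2}(e,x)$ for all $x\in G$. An *induced approximation* (with parameter $M$) is a sequence of families $\{H_n^\rho\}_{\rho\in\mathcal X^{V_n}}$ of self-adjoint operators on $\ell^2(V_n)$ such that: all maps $\rho\mapsto H_n^\rho(x,y)$ are Borel; $M$ is a hopping range parameter of every $H_n^\rho$ with respect to $E_n$; $H_n^\rho(w,v)=H^{\Pi_w^{\sigma_n}(\rho)}(e,g)$ for all $\rho$, all $4M$-good $w\in V_n$, all $v\in B_{E_n}(w,M)$ and the unique $g\in B_S(e,M)$ with $\sigma_n^g(w)=v$; and every $H_n^\rho(v,w)$ lies in $\{H^\omega(x,y):x,y\in G,\ \omega\in\mathcal X^G\}\cup\{0\}$. **Densities of states.** Let $E_H$ be the projection-valued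 spectral measure of a bounded self-adjoint operator $H$. For a finite set $V$ and $H$ on $\ell^2(V)$ put $\vartheta_H(B)=\frac1{|V|}\sum_{v\in V}\langle\delta_v,E_H(B)\delta_v\rangle$. For $H$ on $\ell^2(G)$ with $G$ infinite put $\vartheta_H(B)=\langle\delta_e,E_H(B)\delta_e\rangle$. Let $\vartheta_n^\rho=\vartheta_{H_n^\rho}$, $\vartheta^\omega=\vartheta_{H^\omega}$, and for bounded continuous $f:\mathbb R\to\mathbb R$ let $\vartheta(f)=\int f\,d\vartheta$ and $N'(f)=\int_{\mathcal X^G}\vartheta^\omega(f)\,d\mu(\omega)$. **Theorem.** Let $(V_n,\sigma_n,\mu_n)$ be an ergodically sofic model for a $G$-process $(G,\mathcal X,\mu)$ and let $\{H^\omega\}$ be a continuous operator over $\mathrm{Cay}(G,S)$ with parameter $M$. Assume that all $\sigma_n$ are homomorphisms or that $\{H^\omega\}$ is of bounded interaction. Then for every induced approximation $(\{H_n^\rho\})$ of $\{H^\omega\}$ with parameter $M$, every $\varepsilon>0$ and every bounded continuous $f:\mathbb R\to\mathbb R$, $$\lim_{n\to\infty}\mu_n\big(\{\rho\in\mathcal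 X^{V_n}:\ |\vartheta_n^\rho(f)-N'(f)|<\varepsilon\}\big)=1.$$ -/

import Mathlib

open Filter Topology MeasureTheory
open scoped ENNReal InnerProductSpace BoundedContinuousFunction CompactlySupported

noncomputable section

namespace SoficSpectral

/-! ### Labelled graphs, Cayley graphs and good vertices -/

/-- A graph together with edge labels from `A`; `HasLabel x y a` means that `(x, y)` carries the
label `a`. -/
structure LabelledGraph (V A : Type*) where
  graph : SimpleGraph V
  HasLabel : V → V → A → Prop

/-- The closed ball for the path distance (which is `⊤` between different components). -/
def LabelledGraph.ball {V A : Type*} (Γ : LabelledGraph V A) (v : V) (R : ℕ) : Set V :=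
  {x | Γ.graph.edist v x ≤ R}

/-- `φ` restricts to an isomorphism, between the labelled subgraphs induced on the balls of radius
`R` around `v` and `w`, that takes `v` to `w`. -/
structure IsBallIso {V W A : Type*} (Γ : LabelledGraph V A) (Δ : LabelledGraph W A)
    (v : V) (w : W) (R : ℕ) (φ : V → W) : Prop where
  center : φ v = w
  bijOn : Set.BijOn φ (Γ.ball v R) (Δ.ball w R)
  adj_iff : ∀ x ∈ Γ.ball v R, ∀ y ∈ Γ.ball v R, Γ.graph.Adj x y ↔ Δ.graph.Adj (φ x) (φ y)
  label_iff : ∀ x ∈ Γ.ball v R, ∀ y ∈ Γ.ball v R, ∀ a : A,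
    Γ.HasLabel x y a ↔ Δ.HasLabel (φ x) (φ y) a

/-- `S` is a (finite) symmetric generating set that does not contain the identity. -/
structure IsSymmGenerating {G : Type*} [Group G] (S : Finset G) : Prop where
  one_notMem : (1 : G) ∉ S
  inv_mem : ∀ s ∈ S, s⁻¹ ∈ S
  closure_eq_top : Subgroup.closure (S : Set G) = ⊤

/-- The left Cayley graph: `x` and `y` are adjacent iff `y = s * x` for some `s ∈ S`, and then
`(x, y)` is labelled by `s = y * x⁻¹`. -/
def cayley {G : Type*} [Group G] (S : Finset G) : LabelledGraph G G where
  graph := SimpleGraph.fromRel fun x y => ∃ s ∈ S, s * x = y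
  HasLabel x y s := s ∈ S ∧ s * x = y

/-- The graph on `V` with an edge labelled by `s` from `v` to `σ s v`, for `v : V` and `s ∈ S`
(made symmetric, and with loops removed from the adjacency relation). -/
def soficGraph {G V : Type*} (S : Finset G) (σ : G → Equiv.Perm V) : LabelledGraph V G where
  graph := SimpleGraph.fromRel fun x y => ∃ s ∈ S, σ s x = y
  HasLabel x y s := s ∈ S ∧ σ s x = y

/-- `R`-good vertices: the labelled ball of radius `R` around `v` is isomorphic to the one around
the identity in the Cayley graph, where the vertex corresponding to `g` is `σ g v` (so that for
every `x` in the ball there is a unique `g` in the ball of the Cayley graph with `σ g v = x`). -/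
def IsGood {G V : Type*} [Group G] (S : Finset G) (σ : G → Equiv.Perm V) (R : ℕ) (v : V) : Prop :=
  ∃ φ : V → G, IsBallIso (soficGraph S σ) (cayley S) v 1 R φ ∧
    ∀ x ∈ (soficGraph S σ).ball v R, σ (φ x) v = x

/-! ### Sofic approximations, processes, local and empirical convergence -/

/-- Sofic approximations `(V n, σ n)` of `G`. -/
structure IsSoficApproximation {G : Type*} [Group G] {V : ℕ → Type*} [∀ n, Finite (V n)]
    (σ : ∀ n, G → Equiv.Perm (V n)) : Prop where
  mul : ∀ g h : G, Tendsto
    (fun n => (({v : V n | σ n g (σ n h v) = σ n (g * h) v}.ncard : ℝ) / (Nat.card (V n) : ℝ)))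
    atTop (𝓝 1)
  free : ∀ g : G, g ≠ 1 → Tendsto
    (fun n => (({v : V n | σ n g v ≠ v}.ncard : ℝ) / (Nat.card (V n) : ℝ))) atTop (𝓝 1)

/-- The shift action `(h.ω)_g = ω_{gh}`. -/
def shift {G X : Type*} [Group G] (h : G) (ω : G → X) : G → X := fun g => ω (g * h)

/-- Invariance under the shift action, i.e. `(G, X, μ)` is a `G`-process. -/
def IsProcess {G X : Type*} [Group G] [MeasurableSpace X]
    (μ : ProbabilityMeasure (G → X)) : Prop :=
  ∀ h : G, MeasurePreserving (shift (X := X) h) (μ : Measure (G → X)) (μ : Measure (G → X))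

/-- The lift `Π_v^σ(ρ) = (ρ_{σ^g(v)})_g`. -/
def lift {G V X : Type*} (σ : G → Equiv.Perm V) (v : V) (ρ : V → X) : G → X :=
  fun g => ρ (σ g v)

theorem measurable_lift {G V X : Type*} [MeasurableSpace X] (σ : G → Equiv.Perm V) (v : V) :
    Measurable (lift (X := X) σ v) :=
  measurable_pi_lambda _ fun _ => measurable_pi_apply _

/-- The empirical distribution `(1 / |V|) ∑_v δ_{Π_v^σ(ρ)}`. -/
def empirical {G V X : Type*} [MeasurableSpace X] (σ : G → Equiv.Perm V) (ρ : V → X) :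
    Measure (G → X) :=
  (Nat.card V : ℝ≥0∞)⁻¹ • Measure.sum fun v => Measure.dirac (lift σ v ρ)

/-- `(V n, σ n, μn n)` is an ergodically sofic model for the process `(G, X, μ)`: `σ` is a sofic
approximation, and `μn` converges to `μ` locally weak-* and locally and empirically. The topology
on `ProbabilityMeasure (G → X)` is the weak-* topology. -/
structure IsErgodicallySoficModel {G X : Type*} [Group G] [Countable G]
    [MetricSpace X] [CompactSpace X] [MeasurableSpace X] [BorelSpace X]
    {V : ℕ → Type*} [∀ n, Finite (V n)] (σ : ∀ n, G → Equiv.Perm (V n))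
    (μn : ∀ n, ProbabilityMeasure (V n → X)) (μ : ProbabilityMeasure (G → X)) : Prop where
  sofic : IsSoficApproximation σ
  process : IsProcess μ
  local_weak_tendsto : ∀ O : Set (ProbabilityMeasure (G → X)), IsOpen O → μ ∈ O → Tendsto
    (fun n => ({v : V n | (μn n).map (measurable_lift (σ n) v).aemeasurable ∈ O}.ncard : ℝ) /
      (Nat.card (V n) : ℝ)) atTop (𝓝 1)
  empirical_tendsto : ∀ O : Set (ProbabilityMeasure (G → X)), IsOpen O → μ ∈ O → Tendsto
    (fun n => (μn n : Measure (V n → X))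
      {ρ | ∃ P ∈ O, (P : Measure (G → X)) = empirical (σ n) ρ}) atTop (𝓝 1)

/-! ### Operators -/

/-- The Hilbert space `ℓ²(V)` of complex square summable functions. -/
abbrev ell2 (V : Type*) : Type _ := lp (fun _ : V => ℂ) 2

/-- Bounded operators on `ℓ²(V)`. -/
abbrev Op (V : Type*) : Type _ := ell2 V →L[ℂ] ell2 V

open Classical in
/-- The vector `δ_v`. -/
def delta {V : Type*} (v : V) : ell2 V := lp.single 2 v (1 : ℂ)

/-- The coefficient `H(x, y) = ⟨δ_x, H δ_y⟩` (conjugate linear in the first entry). -/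
def coeff {V : Type*} (H : Op V) (x y : V) : ℂ := ⟪delta x, H (delta y)⟫_ℂ

/-- `M` is a finite hopping range parameter for `H`. -/
def HasHoppingRange {V A : Type*} (Γ : LabelledGraph V A) (M : ℕ) (H : Op V) : Prop :=
  ∀ x y : V, y ∉ Γ.ball x M → coeff H x y = 0

/-- Continuous operators over the Cayley graph, with parameter `M`. -/
structure IsContinuousOperator {G X : Type*} [Group G] [TopologicalSpace X] (S : Finset G)
    (M : ℕ) (H : (G → X) → Op G) : Prop where
  continuous_coeff : ∀ x y : G, Continuous fun ω => coeff (H ω) x y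
  selfAdjoint : ∀ ω, IsSelfAdjoint (H ω)
  hopping : ∀ ω, HasHoppingRange (cayley S) M (H ω)
  equivariant : ∀ (ω : G → X) (x y g : G),
    coeff (H ω) (x * g) (y * g) = coeff (H (shift g ω)) x y

/-- Bounded interaction, with parameter `M`. -/
def HasBoundedInteraction {G X : Type*} [Group G] (S : Finset G) (M : ℕ)
    (H : (G → X) → Op G) : Prop :=
  ∀ ω₁ ω₂ : G → X, (∀ g ∈ (cayley S).ball 1 M, ω₁ g = ω₂ g) →
    ∀ x : G, coeff (H ω₁) 1 x = coeff (H ω₂) 1 x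

/-- Weak approximations, over `(V n, σ n)`, of the family `H` with parameter `M`. -/
structure IsWeakApproximation {G X : Type*} [Group G] [MeasurableSpace X] (S : Finset G)
    {V : ℕ → Type*} (σ : ∀ n, G → Equiv.Perm (V n)) (M : ℕ) (H : (G → X) → Op G)
    (Hn : ∀ n, (V n → X) → Op (V n)) : Prop where
  measurable_coeff : ∀ (n : ℕ) (x y : V n), Measurable fun ρ => coeff (Hn n ρ) x y
  selfAdjoint : ∀ n ρ, IsSelfAdjoint (Hn n ρ)
  hopping : ∀ n ρ, HasHoppingRange (soficGraph S (σ n)) M (Hn n ρ)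
  coeff_eq : ∀ (n : ℕ) (w : V n), IsGood S (σ n) (4 * M) w → ∀ (ρ : V n → X),
    ∀ v ∈ (soficGraph S (σ n)).ball w M, ∀ g ∈ (cayley S).ball 1 M, σ n g w = v →
      coeff (Hn n ρ) w v = coeff (H (lift (σ n) w ρ)) 1 g

/-- Induced approximations, over `(V n, σ n)`, of the family `H` with parameter `M`. -/
structure IsInducedApproximation {G X : Type*} [Group G] [MeasurableSpace X] (S : Finset G)
    {V : ℕ → Type*} (σ : ∀ n, G → Equiv.Perm (V n)) (M : ℕ) (H : (G → X) → Op G)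
    (Hn : ∀ n, (V n → X) → Op (V n)) : Prop extends IsWeakApproximation S σ M H Hn where
  coeff_mem : ∀ (n : ℕ) (ρ : V n → X) (v w : V n),
    coeff (Hn n ρ) v w ∈ {c : ℂ | ∃ (x y : G) (ω : G → X), c = coeff (H ω) x y} ∪ {0}

/-! ### Spectral measures and the density of states -/

/-- The positive functional `f ↦ ⟨ψ, f(T) ψ⟩` on `C_c(ℝ)`, for the continuous functional calculus of
the operator `T`. -/
def spectralFunctional {E : Type*} [NormedAddCommGroup E] [InnerProductSpace ℂ E] [CompleteSpace E]
    (T : E →L[ℂ] E) (ψ : E) : C_c(ℝ, ℝ) →ₚ[ℝ] ℝ :=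
  PositiveLinearMap.mk₀
    { toFun := fun f => (⟪ψ, cfc (fun x => f x) T ψ⟫_ℂ).re
      map_add' := fun f g => by
        have h : cfc (fun x => (f + g) x) T = cfc (fun x => f x) T + cfc (fun x => g x) T :=
          cfc_add (a := T) (fun x => f x) (fun x => g x) f.continuous.continuousOn
            g.continuous.continuousOn
        rw [h]
        simp
      map_smul' := fun c f => by
        have h : cfc (fun x => (c • f) x) T = c • cfc (fun x => f x) T :=
          cfc_smul (a := T) c (fun x => f x) f.continuous.continuousOn
        rw [h, smul_apply, ← Complex.coe_smul, inner_smul_right]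
        simp }
    (fun f hf => by
      have h : 0 ≤ cfc (fun x => f x) T := cfc_nonneg fun x _ => hf x
      exact ((ContinuousLinearMap.nonneg_iff_isPositive _).mp h).re_inner_nonneg_right ψ)

/-- The spectral measure of the self-adjoint operator `T` at the vector `ψ`, that is
`B ↦ ⟨ψ, E_T(B) ψ⟩`: the Borel measure on `ℝ` that represents `f ↦ ⟨ψ, f(T) ψ⟩`. -/
def spectralMeasure {E : Type*} [NormedAddCommGroup E] [InnerProductSpace ℂ E] [CompleteSpace E]
    (T : E →L[ℂ] E) (ψ : E) : Measure ℝ :=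
  RealRMK.rieszMeasure (spectralFunctional T ψ)

/-- For a finite set `V`: the normalized trace `B ↦ (1 / |V|) ∑_v ⟨δ_v, E_T(B) δ_v⟩`. -/
def traceMeasure {V : Type*} (T : Op V) : Measure ℝ :=
  (Nat.card V : ℝ≥0∞)⁻¹ • Measure.sum fun v : V => spectralMeasure T (delta v)

open Classical in
/-- The measure `ϑ` attached to an operator on `ℓ²(G)`: the normalized trace measure if `G` is
finite, and `B ↦ ⟨δ_e, E_T(B) δ_e⟩` if `G` is infinite. -/
def groupMeasure {G : Type*} [Group G] (T : Op G) : Measure ℝ :=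
  if Finite G then traceMeasure T else spectralMeasure T (delta 1)

/-- The density of states measure `N'(f) = ∫ ϑ^ω(f) dμ(ω)`. -/
def densityOfStates {G X : Type*} [Group G] [MeasurableSpace X]
    (μ : ProbabilityMeasure (G → X)) (H : (G → X) → Op G) (f : ℝ →ᵇ ℝ) : ℝ :=
  ∫ ω, (∫ s, f s ∂(groupMeasure (H ω))) ∂(μ : Measure (G → X))

end SoficSpectral

end

noncomputable section

namespace SoficSpectral

/-! ### Integration against spectral measures -/

section Spectral

variable {E : Type*} [NormedAddCommGroup E] [InnerProductSpace ℂ E] [CompleteSpace E]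

/-! All operators involved have norm at most one constant C, by a Schur test
(`norm_le_of_coeff_bound`). On [-C, C] the function f is uniformly close to a polynomial p, and the
diagonal coefficient of p(T) at v depends only on finitely many coefficients of T near v. For almost
all v these agree with the coefficients of the limit operator at the configuration ω = Π_v(ρ) near
the identity, by soficity together with the homomorphism or bounded interaction assumption
(`almostAll_coeff_eq`, `pow_delta_eq_of_local`).

With φ(ω) = ⟨δ_e, f(H^ω) δ_e⟩, the trace ϑ_n^ρ(f) is therefore close, uniformly in ρ, to the average
of φ(Π_v(ρ)) over v, which is the integral of φ against the empirical distribution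
(`eventually_average_near`). Since φ is continuous (`continuous_diagCfc`), empirical convergence
brings this near ∫ φ dμ with probability tending to one, and that integral is N'(f)
(`densityOfStates_eq`). -/

theorem abs_le_of_mem_spectrum {T : E →L[ℂ] E} {C : ℝ} (hC : ‖T‖ ≤ C) {x : ℝ}
    (hx : x ∈ spectrum ℝ T) : |x| ≤ C := by
  have h := spectrum.norm_le_norm_mul_of_mem hx
  -- Only an inequality, because E may be the zero space.
  have h1 : ‖(1 : E →L[ℂ] E)‖ ≤ 1 := ContinuousLinearMap.norm_id_le
  calc |x| ≤ ‖T‖ * ‖(1 : E →L[ℂ] E)‖ := h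
    _ ≤ ‖T‖ * 1 := by gcongr
    _ ≤ C := by linarith

theorem integral_spectralMeasure_of_compactSupport (T : E →L[ℂ] E) (ψ : E) (f : C_c(ℝ, ℝ)) :
    ∫ s, f s ∂(spectralMeasure T ψ) = (⟪ψ, cfc (fun x => f x) T ψ⟫_ℂ).re :=
  RealRMK.integral_rieszMeasure _ f

/-- A nonnegative function that is positive exactly where `C < |x| < m`. -/
def annulusBump (C m : ℝ) : C_c(ℝ, ℝ) where
  toFun x := min (max 0 (|x| - C)) (max 0 (m - |x|))
  continuous_toFun := by fun_prop
  hasCompactSupport' := by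
    refine HasCompactSupport.intro (isCompact_Icc (a := -m) (b := m)) fun x hx => ?_
    have : m < |x| := by
      by_contra h
      exact hx (abs_le.mp (not_lt.mp h))
    rw [max_eq_left (by linarith : m - |x| ≤ 0)]
    exact min_eq_right (le_max_left _ _)

theorem annulusBump_apply (C m x : ℝ) :
    annulusBump C m x = min (max 0 (|x| - C)) (max 0 (m - |x|)) := rfl

/-- A compactly supported function that equals one on `[-C, C]`. -/
def plateau (C : ℝ) : C_c(ℝ, ℝ) where
  toFun x := min 1 (max 0 (C + 1 - |x|))
  continuous_toFun := by fun_prop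
  hasCompactSupport' := by
    refine HasCompactSupport.intro (isCompact_Icc (a := -(C + 1)) (b := C + 1)) fun x hx => ?_
    have : C + 1 < |x| := by
      by_contra h
      exact hx (abs_le.mp (not_lt.mp h))
    rw [max_eq_left (by linarith : C + 1 - |x| ≤ 0)]
    exact min_eq_right zero_le_one

theorem plateau_eq_one {C x : ℝ} (hx : |x| ≤ C) : plateau C x = 1 := by
  change min 1 (max 0 (C + 1 - |x|)) = 1
  exact min_eq_left (le_max_of_le_right (by linarith))

/-- The Riesz measure is accessible only through compactly supported functions. Each annulus bump
vanishes on the spectrum, so its integral is zero and it vanishes almost everywhere; countably many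
bumps exhaust |s| > C. -/
theorem ae_spectralMeasure_abs_le (T : E →L[ℂ] E) (ψ : E) {C : ℝ} (hC : ‖T‖ ≤ C) :
    ∀ᵐ s ∂(spectralMeasure T ψ), |s| ≤ C := by
  have : (spectralMeasure T ψ).Regular := RealRMK.regular_rieszMeasure _
  have key : ∀ m : ℕ, ∀ᵐ s ∂(spectralMeasure T ψ), annulusBump C m s = 0 := by
    intro m
    have h0 : ∫ s, annulusBump C m s ∂(spectralMeasure T ψ) = 0 := by
      rw [integral_spectralMeasure_of_compactSupport]
      have : cfc (fun x => annulusBump C m x) T = cfc (fun _ : ℝ => (0 : ℝ)) T := by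
        refine cfc_congr fun x hx => ?_
        have := abs_le_of_mem_spectrum hC hx
        change annulusBump C m x = 0
        rw [annulusBump_apply, max_eq_left (by linarith : |x| - C ≤ 0)]
        exact min_eq_left (le_max_left _ _)
      rw [this, cfc_const_zero]
      simp
    have hi : Integrable (fun s => annulusBump C m s) (spectralMeasure T ψ) :=
      (annulusBump C m).continuous.integrable_of_hasCompactSupport
        (annulusBump C m).hasCompactSupport
    have := (integral_eq_zero_iff_of_nonneg (fun s => ?_) hi).mp h0
    · exact this
    · rw [annulusBump_apply]
      exact le_min (le_max_left _ _) (le_max_left _ _)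
  filter_upwards [ae_all_iff.mpr key] with s hs
  by_contra h
  obtain ⟨m, hm⟩ := exists_nat_gt |s|
  have h1 := hs m
  rw [annulusBump_apply] at h1
  have h2 : 0 < min (max 0 (|s| - C)) (max 0 ((m : ℝ) - |s|)) :=
    lt_min (lt_max_of_lt_right (by linarith [not_le.mp h])) (lt_max_of_lt_right (by linarith))
  exact h2.ne' h1

theorem integral_spectralMeasure (T : E →L[ℂ] E) (ψ : E) (f : ℝ →ᵇ ℝ) :
    Integrable f (spectralMeasure T ψ) ∧
      ∫ s, f s ∂(spectralMeasure T ψ) = (⟪ψ, cfc (fun x => f x) T ψ⟫_ℂ).re := by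
  -- Regularity makes the measure finite on compact sets, so compactly supported continuous
  -- functions are integrable.
  have : (spectralMeasure T ψ).Regular := RealRMK.regular_rieszMeasure _
  let g : C_c(ℝ, ℝ) :=
    ⟨⟨fun x => f x * plateau ‖T‖ x, f.continuous.mul (plateau ‖T‖).continuous⟩,
      (plateau ‖T‖).hasCompactSupport.mul_left⟩
  have hg : ∀ x, g x = f x * plateau ‖T‖ x := fun _ => rfl
  have hae : (fun s => g s) =ᵐ[spectralMeasure T ψ] f := by
    filter_upwards [ae_spectralMeasure_abs_le T ψ le_rfl] with s hs
    rw [hg, plateau_eq_one hs, mul_one]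
  have hi : Integrable (fun s => g s) (spectralMeasure T ψ) :=
    g.continuous.integrable_of_hasCompactSupport g.hasCompactSupport
  refine ⟨hi.congr hae, ?_⟩
  rw [← integral_congr_ae hae, integral_spectralMeasure_of_compactSupport]
  congr 3
  refine cfc_congr fun x hx => ?_
  rw [hg, plateau_eq_one (abs_le_of_mem_spectrum le_rfl hx), mul_one]

/-- The number `⟨ψ, f(T) ψ⟩`. -/
def quadCfc (f : ℝ → ℝ) (T : E →L[ℂ] E) (ψ : E) : ℝ :=
  (⟪ψ, cfc f T ψ⟫_ℂ).re

theorem abs_re_inner_cfc_sub_le {T : E →L[ℂ] E} (hT : IsSelfAdjoint T) {C : ℝ} (hC : ‖T‖ ≤ C)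
    {f : ℝ → ℝ} (hf : Continuous f) {p : Polynomial ℝ} {η : ℝ} (hη : 0 ≤ η)
    (hp : ∀ x, |x| ≤ C → |f x - p.eval x| ≤ η) {ψ : E} (hψ : ‖ψ‖ = 1) :
    |quadCfc f T ψ - (⟪ψ, Polynomial.aeval T p ψ⟫_ℂ).re| ≤ η := by
  have h1 : cfc f T - Polynomial.aeval T p = cfc (fun x => f x - p.eval x) T := by
    rw [cfc_sub (a := T) f p.eval hf.continuousOn p.continuous.continuousOn, cfc_polynomial p T hT]
  have h2 : ‖cfc (fun x => f x - p.eval x) T‖ ≤ η :=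
    norm_cfc_le hη fun x hx => hp x (abs_le_of_mem_spectrum hC hx)
  rw [quadCfc, ← Complex.sub_re, ← inner_sub_right, ← sub_apply, h1]
  calc _ ≤ ‖⟪ψ, cfc (fun x => f x - p.eval x) T ψ⟫_ℂ‖ := Complex.abs_re_le_norm _
    _ ≤ ‖ψ‖ * ‖cfc (fun x => f x - p.eval x) T ψ‖ := norm_inner_le_norm _ _
    _ ≤ ‖ψ‖ * (‖cfc (fun x => f x - p.eval x) T‖ * ‖ψ‖) := by
        gcongr; exact ContinuousLinearMap.le_opNorm _ _
    _ ≤ η := by rw [hψ]; linarith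

/-- Self-adjointness is not required: otherwise `cfc` takes its default value zero. -/
theorem abs_re_inner_cfc_le {T : E →L[ℂ] E} (f : ℝ →ᵇ ℝ) {ψ : E} (hψ : ‖ψ‖ = 1) :
    |quadCfc f T ψ| ≤ ‖f‖ := by
  have h2 : ‖cfc (fun x => f x) T‖ ≤ ‖f‖ :=
    norm_cfc_le (norm_nonneg f) fun x _ => f.norm_coe_le_norm x
  calc _ ≤ ‖⟪ψ, cfc (fun x => f x) T ψ⟫_ℂ‖ := Complex.abs_re_le_norm _
    _ ≤ ‖ψ‖ * ‖cfc (fun x => f x) T ψ‖ := norm_inner_le_norm _ _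
    _ ≤ ‖ψ‖ * (‖cfc (fun x => f x) T‖ * ‖ψ‖) := by
        gcongr; exact ContinuousLinearMap.le_opNorm _ _
    _ ≤ ‖f‖ := by rw [hψ]; linarith

end Spectral

/-! ### Diagonal coefficients, trace measures and empirical averages -/

theorem inner_aeval {E : Type*} [NormedAddCommGroup E] [InnerProductSpace ℂ E]
    (T : E →L[ℂ] E) (p : Polynomial ℝ) (ψ : E) :
    ⟪ψ, Polynomial.aeval T p ψ⟫_ℂ =
      ∑ i ∈ Finset.range (p.natDegree + 1), (p.coeff i : ℂ) * ⟪ψ, (T ^ i) ψ⟫_ℂ := by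
  rw [Polynomial.aeval_eq_sum_range, sum_apply, inner_sum]
  refine Finset.sum_congr rfl fun i _ => ?_
  rw [smul_apply, ← Complex.coe_smul, inner_smul_right]

/-- The number `⟨δ_v, f(T) δ_v⟩`. -/
def diagCfc {V : Type*} (f : ℝ → ℝ) (T : Op V) (v : V) : ℝ :=
  quadCfc f T (delta v)

theorem norm_delta {V : Type*} (v : V) : ‖(delta v : ell2 V)‖ = 1 := by
  classical
  simp only [delta]
  rw [lp.norm_single (by norm_num)]
  simp

theorem abs_diagCfc_le {V : Type*} (f : ℝ →ᵇ ℝ) (T : Op V) (v : V) :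
    |diagCfc f T v| ≤ ‖f‖ :=
  abs_re_inner_cfc_le f (norm_delta v)

theorem integral_traceMeasure {V : Type*} [Fintype V] (T : Op V) (f : ℝ →ᵇ ℝ) :
    ∫ s, f s ∂(traceMeasure T) = (Fintype.card V : ℝ)⁻¹ * ∑ v, diagCfc f T v := by
  rw [traceMeasure, integral_smul_measure, Measure.sum_fintype,
    integral_finsetSum_measure fun v _ => (integral_spectralMeasure T (delta v) f).1]
  -- For empty V the scalar is ∞, and its `toReal` agrees with the real 0⁻¹ = 0.
  simp only [ENNReal.toReal_inv, Nat.card_eq_fintype_card, ENNReal.toReal_natCast, smul_eq_mul]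
  congr 1
  exact Finset.sum_congr rfl fun v _ => (integral_spectralMeasure T (delta v) f).2

theorem integral_empirical {G V X : Type*} [MeasurableSpace X] [Fintype V]
    (σ : G → Equiv.Perm V) (ρ : V → X) {φ : (G → X) → ℝ} (hφ : StronglyMeasurable φ) :
    ∫ ω, φ ω ∂(empirical σ ρ) = (Fintype.card V : ℝ)⁻¹ * ∑ v, φ (lift σ v ρ) := by
  rw [empirical, integral_smul_measure, Measure.sum_fintype,
    integral_finsetSum_measure fun v _ => integrable_dirac' hφ (by simp)]
  simp only [ENNReal.toReal_inv, Nat.card_eq_fintype_card, ENNReal.toReal_natCast, smul_eq_mul]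
  congr 1
  exact Finset.sum_congr rfl fun v _ => integral_dirac' _ _ hφ

/-! ### Matrix coefficients and a Schur test -/

theorem inner_delta_left {V : Type*} (v : V) (u : ell2 V) : ⟪delta v, u⟫_ℂ = u v := by
  classical
  have : (delta v : ell2 V) = lp.single 2 v (1 : ℂ) := by
    simp only [delta]
  rw [this, lp.inner_single_left]
  simp

theorem delta_self {V : Type*} (v : V) : (delta v : ell2 V) v = 1 := by
  classical
  simp [delta]

theorem delta_of_ne {V : Type*} {v w : V} (h : w ≠ v) : (delta v : ell2 V) w = 0 := by
  classical
  simp [delta, h]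

/-- Moving T onto δ_x turns the value at x into a pairing with a finitely supported vector, so u
need not be expanded. -/
theorem apply_eq_sum {V : Type*} {T : Op V} (hT : IsSelfAdjoint T) {x : V} {N : Finset V}
    (hN : ∀ y, y ∉ N → coeff T x y = 0) (u : ell2 V) :
    T u x = ∑ y ∈ N, coeff T x y * u y := by
  have hsymm : ∀ a b : ell2 V, ⟪T a, b⟫_ℂ = ⟪a, T b⟫_ℂ := fun a b => hT.isSymmetric a b
  have hconj : ∀ y, (starRingEnd ℂ) (T (delta x) y) = coeff T x y := fun y => by
    rw [← inner_delta_left y, inner_conj_symm, hsymm]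
    rfl
  rw [← inner_delta_left x, ← hsymm, lp.inner_eq_tsum, tsum_eq_sum (s := N)]
  · refine Finset.sum_congr rfl fun y _ => ?_
    rw [← hconj, RCLike.inner_apply, mul_comm]
  · intro y hy
    rw [RCLike.inner_apply, hconj, hN y hy, mul_zero]

/-- A Schur test for operators with uniformly bounded coefficients and uniformly few nonzero
coefficients in each row and column. -/
theorem norm_le_of_coeff_bound {V : Type*} {T : Op V} (hT : IsSelfAdjoint T) (N : V → Finset V)
    (hN : ∀ x y, y ∉ N x → coeff T x y = 0) {D : ℕ} (hrow : ∀ x, (N x).card ≤ D)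
    (N' : V → Finset V) (hN' : ∀ x y, y ∈ N x → x ∈ N' y) (hcol : ∀ y, (N' y).card ≤ D)
    {B : ℝ} (hB : 0 ≤ B) (hcoeff : ∀ x y, ‖coeff T x y‖ ≤ B) :
    ‖T‖ ≤ B * D := by
  classical
  refine ContinuousLinearMap.opNorm_le_bound _ (by positivity) fun u => ?_
  refine lp.norm_le_of_forall_sum_le (by norm_num) (by positivity) fun s => ?_
  simp only [ENNReal.toReal_ofNat, Real.rpow_ofNat]
  have hsq : ∀ t : Finset V, ∑ y ∈ t, ‖u y‖ ^ 2 ≤ ‖u‖ ^ 2 := fun t => by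
    have := lp.sum_rpow_le_norm_rpow (p := 2) (by norm_num) u t
    simpa only [ENNReal.toReal_ofNat, Real.rpow_ofNat] using this
  have hentry : ∀ x, ‖T u x‖ ^ 2 ≤ D * B ^ 2 * ∑ y ∈ N x, ‖u y‖ ^ 2 := fun x => by
    have h1 : ‖T u x‖ ≤ ∑ y ∈ N x, B * ‖u y‖ := by
      rw [apply_eq_sum hT (hN x)]
      refine (norm_sum_le _ _).trans (Finset.sum_le_sum fun y _ => ?_)
      rw [norm_mul]
      gcongr
      exact hcoeff x y
    calc ‖T u x‖ ^ 2 ≤ (∑ y ∈ N x, B * ‖u y‖) ^ 2 := by gcongr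
      _ ≤ (N x).card * ∑ y ∈ N x, (B * ‖u y‖) ^ 2 := sq_sum_le_card_mul_sum_sq
      _ ≤ D * ∑ y ∈ N x, (B * ‖u y‖) ^ 2 := by
          gcongr
          exact_mod_cast hrow x
      _ = D * B ^ 2 * ∑ y ∈ N x, ‖u y‖ ^ 2 := by
          simp only [mul_pow, ← Finset.mul_sum]
          ring
  have hdouble : ∑ x ∈ s, ∑ y ∈ N x, ‖u y‖ ^ 2 ≤ D * ‖u‖ ^ 2 := by
    -- After exchanging the sums, each y is counted at most D times, by the column bound.
    rw [Finset.sum_comm' (t' := s.biUnion N) (s' := fun y => s.filter fun x => y ∈ N x)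
      (fun x y => by simp only [Finset.mem_filter, Finset.mem_biUnion]; tauto)]
    calc ∑ y ∈ s.biUnion N, ∑ x ∈ s.filter fun x => y ∈ N x, ‖u y‖ ^ 2
        ≤ ∑ y ∈ s.biUnion N, D * ‖u y‖ ^ 2 := by
          refine Finset.sum_le_sum fun y _ => ?_
          rw [Finset.sum_const, nsmul_eq_mul]
          gcongr
          refine (Finset.card_le_card fun x hx => ?_).trans (hcol y)
          exact hN' x y (Finset.mem_filter.mp hx).2
      _ = D * ∑ y ∈ s.biUnion N, ‖u y‖ ^ 2 := by rw [Finset.mul_sum]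
      _ ≤ D * ‖u‖ ^ 2 := by gcongr; exact hsq _
  calc ∑ x ∈ s, ‖T u x‖ ^ 2 ≤ ∑ x ∈ s, D * B ^ 2 * ∑ y ∈ N x, ‖u y‖ ^ 2 :=
        Finset.sum_le_sum fun x _ => hentry x
    _ = D * B ^ 2 * ∑ x ∈ s, ∑ y ∈ N x, ‖u y‖ ^ 2 := by rw [Finset.mul_sum]
    _ ≤ D * B ^ 2 * (D * ‖u‖ ^ 2) := by gcongr
    _ = (B * D * ‖u‖) ^ 2 := by ring

/-! ### Balls -/

theorem LabelledGraph.mem_ball_zero {V A : Type*} (Γ : LabelledGraph V A) {v x : V} :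
    x ∈ Γ.ball v 0 ↔ x = v := by
  simp [LabelledGraph.ball, eq_comm (a := x)]

theorem LabelledGraph.mem_ball_comm {V A : Type*} (Γ : LabelledGraph V A) {v x : V} {r : ℕ} :
    x ∈ Γ.ball v r ↔ v ∈ Γ.ball x r := by
  simp [LabelledGraph.ball, SimpleGraph.edist_comm]

theorem LabelledGraph.ball_mono {V A : Type*} (Γ : LabelledGraph V A) (v : V) :
    Monotone (Γ.ball v) := fun r s hrs x (hx : Γ.graph.edist v x ≤ r) =>
  show Γ.graph.edist v x ≤ s from hx.trans (by exact_mod_cast hrs)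

theorem LabelledGraph.mem_ball_succ {V A : Type*} (Γ : LabelledGraph V A) {v x : V} {r : ℕ} :
    x ∈ Γ.ball v (r + 1) ↔ x ∈ Γ.ball v r ∨ ∃ y ∈ Γ.ball v r, Γ.graph.Adj y x := by
  constructor
  · intro hx
    -- Reversing the walk makes the edge at x its first edge, which `cases` exposes.
    rw [Γ.mem_ball_comm] at hx
    have hx' : Γ.graph.edist x v ≤ (r + 1 : ℕ) := hx
    obtain ⟨p, hp⟩ := SimpleGraph.exists_walk_of_edist_ne_top
      (ne_top_of_le_ne_top (ENat.natCast_ne_top _) hx')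
    rw [← hp, Nat.cast_le] at hx'
    cases p with
    | nil => exact Or.inl (by simp [LabelledGraph.ball])
    | @cons _ y _ hadj q =>
      refine Or.inr ⟨y, Γ.mem_ball_comm.mpr ?_, hadj.symm⟩
      have hq : q.length ≤ r := by simpa using hx'
      exact (SimpleGraph.edist_le q).trans (by exact_mod_cast hq)
  · rintro (hx | ⟨y, hy, hadj⟩)
    · exact Γ.ball_mono v (Nat.le_succ r) hx
    · have hy' : Γ.graph.edist v y ≤ r := hy
      have h1 : Γ.graph.edist y x = 1 := SimpleGraph.edist_eq_one_iff_adj.mpr hadj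
      refine (SimpleGraph.edist_triangle (v := y)).trans ?_
      rw [h1]
      push_cast
      gcongr

theorem LabelledGraph.exists_ball_subset {V A : Type*} (Γ : LabelledGraph V A) {d : ℕ}
    (nb : V → Finset V) (hnb : ∀ x y, Γ.graph.Adj x y → y ∈ nb x) (hd : ∀ x, (nb x).card ≤ d)
    (r : ℕ) (v : V) : ∃ N : Finset V, Γ.ball v r ⊆ N ∧ N.card ≤ (d + 1) ^ r := by
  classical
  induction r with
  | zero => exact ⟨{v}, fun x hx => by simp [Γ.mem_ball_zero.mp hx], by simp⟩
  | succ r ih =>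
    obtain ⟨N, hN, hc⟩ := ih
    refine ⟨N ∪ N.biUnion nb, fun x hx => ?_, ?_⟩
    · rcases Γ.mem_ball_succ.mp hx with hx | ⟨y, hy, hadj⟩
      · exact Finset.mem_coe.mpr (Finset.mem_union_left _ (hN hx))
      · exact Finset.mem_coe.mpr (Finset.mem_union_right _
          (Finset.mem_biUnion.mpr ⟨y, hN hy, hnb _ _ hadj⟩))
    · calc (N ∪ N.biUnion nb).card ≤ N.card + (N.biUnion nb).card := Finset.card_union_le _ _
        _ ≤ N.card + N.card * d := by
            gcongr
            exact Finset.card_biUnion_le_card_mul _ _ _ fun x _ => hd x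
        _ = N.card * (d + 1) := by ring
        _ ≤ (d + 1) ^ r * (d + 1) := by gcongr
        _ = (d + 1) ^ (r + 1) := by ring

theorem soficGraph_adj {G V : Type*} {S : Finset G} {σ : G → Equiv.Perm V} {x y : V} :
    (soficGraph S σ).graph.Adj x y ↔ x ≠ y ∧ ((∃ s ∈ S, σ s x = y) ∨ ∃ s ∈ S, σ s y = x) :=
  SimpleGraph.fromRel_adj _ _ _

theorem cayley_adj {G : Type*} [Group G] {S : Finset G} {x y : G} :
    (cayley S).graph.Adj x y ↔ x ≠ y ∧ ((∃ s ∈ S, s * x = y) ∨ ∃ s ∈ S, s * y = x) :=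
  SimpleGraph.fromRel_adj _ _ _

/-- Neighbours arise from each σ s and its inverse permutation; the latter need not be σ s⁻¹, hence
the degree bound 2|S|, which depends on neither σ nor V. -/
theorem exists_soficGraph_ball_subset {G V : Type*} (S : Finset G) (σ : G → Equiv.Perm V)
    (r : ℕ) (v : V) :
    ∃ N : Finset V, (soficGraph S σ).ball v r ⊆ N ∧ N.card ≤ (S.card + S.card + 1) ^ r := by
  classical
  refine (soficGraph S σ).exists_ball_subset
    (fun x => S.image (fun s => σ s x) ∪ S.image fun s => (σ s).symm x) (fun x y h => ?_)
    (fun x => (Finset.card_union_le _ _).trans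
      (add_le_add Finset.card_image_le Finset.card_image_le)) r v
  rw [Finset.mem_union, Finset.mem_image, Finset.mem_image]
  rcases (soficGraph_adj.mp h).2 with ⟨s, hs, h⟩ | ⟨s, hs, h⟩
  · exact Or.inl ⟨s, hs, h⟩
  · exact Or.inr ⟨s, hs, (Equiv.symm_apply_eq _).mpr h.symm⟩

theorem finite_cayley_ball {G : Type*} [Group G] (S : Finset G) (r : ℕ) (v : G) :
    ((cayley S).ball v r).Finite := by
  -- The Cayley graph is the sofic graph of left multiplication.
  obtain ⟨N, hN, -⟩ := exists_soficGraph_ball_subset S (fun s : G => Equiv.mulLeft s) r v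
  exact N.finite_toSet.subset hN

theorem one_mem_cayley_ball {G : Type*} [Group G] (S : Finset G) (r : ℕ) :
    (1 : G) ∈ (cayley S).ball 1 r := by
  simp [LabelledGraph.ball]

theorem mem_cayley_ball_succ {G : Type*} [Group G] {S : Finset G} (hS : IsSymmGenerating S)
    {r : ℕ} {g : G} :
    g ∈ (cayley S).ball 1 (r + 1) ↔
      g ∈ (cayley S).ball 1 r ∨ ∃ s ∈ S, ∃ h ∈ (cayley S).ball 1 r, g = s * h := by
  rw [LabelledGraph.mem_ball_succ]
  constructor
  · rintro (h | ⟨y, hy, hadj⟩)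
    · exact Or.inl h
    · rcases (cayley_adj.mp hadj).2 with ⟨s, hs, h⟩ | ⟨s, hs, h⟩
      · exact Or.inr ⟨s, hs, y, hy, h.symm⟩
      · exact Or.inr ⟨s⁻¹, hS.inv_mem s hs, y, hy, by rw [← h]; group⟩
  · rintro (h | ⟨s, hs, y, hy, rfl⟩)
    · exact Or.inl h
    · by_cases hy' : y = s * y
      · exact Or.inl (hy' ▸ hy)
      · exact Or.inr ⟨y, hy, cayley_adj.mpr ⟨hy', Or.inl ⟨s, hs, rfl⟩⟩⟩

theorem mul_mem_cayley_ball {G : Type*} [Group G] {S : Finset G} (hS : IsSymmGenerating S)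
    {q r : ℕ} {g h : G} (hg : g ∈ (cayley S).ball 1 q) (hh : h ∈ (cayley S).ball 1 r) :
    g * h ∈ (cayley S).ball 1 (q + r) := by
  induction q generalizing g with
  | zero =>
    rw [LabelledGraph.mem_ball_zero] at hg
    simpa [hg] using hh
  | succ q ih =>
    rw [show q + 1 + r = (q + r) + 1 by ring, mem_cayley_ball_succ hS]
    rcases (mem_cayley_ball_succ hS).mp hg with hg | ⟨s, hs, k, hk, rfl⟩
    · exact Or.inl (ih hg)
    · exact Or.inr ⟨s, hs, k * h, ih hk, mul_assoc _ _ _⟩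

theorem mem_cayley_ball_one {G : Type*} [Group G] {S : Finset G} (hS : IsSymmGenerating S)
    {s : G} (hs : s ∈ S) : s ∈ (cayley S).ball 1 1 :=
  (mem_cayley_ball_succ (r := 0) hS).mpr
    (Or.inr ⟨s, hs, 1, one_mem_cayley_ball S 0, (mul_one s).symm⟩)

theorem inv_mem_cayley_ball {G : Type*} [Group G] {S : Finset G} (hS : IsSymmGenerating S)
    {r : ℕ} {g : G} (hg : g ∈ (cayley S).ball 1 r) : g⁻¹ ∈ (cayley S).ball 1 r := by
  induction r generalizing g with
  | zero =>
    rw [LabelledGraph.mem_ball_zero] at hg ⊢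
    simp [hg]
  | succ r ih =>
    rcases (mem_cayley_ball_succ hS).mp hg with hg | ⟨s, hs, k, hk, rfl⟩
    · exact LabelledGraph.ball_mono _ _ (Nat.le_succ r) (ih hg)
    · rw [mul_inv_rev]
      exact mul_mem_cayley_ball hS (ih hk) (mem_cayley_ball_one hS (hS.inv_mem s hs))

/-! ### Continuous families of operators over the Cayley graph -/

/-- The ball around the identity in the Cayley graph, as a finset. -/
def cayleyBall {G : Type*} [Group G] (S : Finset G) (r : ℕ) : Finset G :=
  (finite_cayley_ball S r 1).toFinset

theorem mem_cayleyBall {G : Type*} [Group G] {S : Finset G} {r : ℕ} {g : G} :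
    g ∈ cayleyBall S r ↔ g ∈ (cayley S).ball 1 r :=
  Set.Finite.mem_toFinset _

theorem exists_polynomial_near (f : ℝ →ᵇ ℝ) (C : ℝ) {η : ℝ} (hη : 0 < η) :
    ∃ p : Polynomial ℝ, ∀ x, |x| ≤ C → |f x - p.eval x| ≤ η := by
  obtain ⟨p, hp⟩ := exists_polynomial_near_of_continuousOn (-C) C f f.continuous.continuousOn η hη
  refine ⟨p, fun x hx => ?_⟩
  rw [abs_sub_comm]
  exact (hp x (abs_le.mp hx)).le

/-- The diagonal coefficient of `p(T)` at `v`. -/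
def diagPoly {V : Type*} (p : Polynomial ℝ) (T : Op V) (v : V) : ℂ :=
  ∑ i ∈ Finset.range (p.natDegree + 1), (p.coeff i : ℂ) * (T ^ i) (delta v) v

theorem abs_diagCfc_sub_le {V : Type*} {T : Op V} (hT : IsSelfAdjoint T) {C : ℝ} (hC : ‖T‖ ≤ C)
    (f : ℝ →ᵇ ℝ) {p : Polynomial ℝ} {η : ℝ} (hη : 0 ≤ η)
    (hp : ∀ x, |x| ≤ C → |f x - p.eval x| ≤ η) (v : V) :
    |diagCfc f T v - (diagPoly p T v).re| ≤ η := by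
  have h := abs_re_inner_cfc_sub_le hT hC f.continuous hη hp (norm_delta v)
  have h' : ⟪delta v, Polynomial.aeval T p (delta v)⟫_ℂ = diagPoly p T v := by
    refine (inner_aeval T p (delta v)).trans (Finset.sum_congr rfl fun i _ => ?_)
    rw [inner_delta_left]
  exact h' ▸ h

theorem pow_succ_apply {V : Type*} (T : Op V) (k : ℕ) (u : ell2 V) :
    (T ^ (k + 1)) u = T ((T ^ k) u) := by
  rw [pow_succ']
  rfl

namespace IsContinuousOperator

variable {G X : Type*} [Group G] [TopologicalSpace X] {S : Finset G} {M : ℕ}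
  {H : (G → X) → Op G}

/-- Equivariance moves every row to the row of the identity, where compactness and bounded
interaction apply. -/
theorem coeff_mul_left (hH : IsContinuousOperator S M H) (ω : G → X) (x b : G) :
    coeff (H ω) x (b * x) = coeff (H (shift x ω)) 1 b := by
  rw [← hH.equivariant, one_mul]

theorem coeff_eq_zero (hH : IsContinuousOperator S M H) (ω : G → X) {x y : G}
    (h : y * x⁻¹ ∉ (cayley S).ball 1 M) : coeff (H ω) x y = 0 := by
  have := hH.coeff_mul_left ω x (y * x⁻¹)
  rw [inv_mul_cancel_right] at this
  rw [this]
  exact hH.hopping _ _ _ h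

theorem apply_eq (hH : IsContinuousOperator S M H) (ω : G → X) (u : ell2 G) (x : G) :
    H ω u x = ∑ b ∈ cayleyBall S M, coeff (H ω) x (b * x) * u (b * x) := by
  classical
  rw [apply_eq_sum (hH.selfAdjoint ω) (x := x) (N := (cayleyBall S M).image (· * x))]
  · exact Finset.sum_image fun a _ b _ h => mul_right_cancel h
  · intro y hy
    refine hH.coeff_eq_zero ω fun h => hy (Finset.mem_image.mpr ⟨y * x⁻¹, mem_cayleyBall.mpr h, ?_⟩)
    simp

theorem exists_coeff_bound [CompactSpace X] (hH : IsContinuousOperator S M H) :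
    ∃ B : ℝ, 0 ≤ B ∧ ∀ ω x y, ‖coeff (H ω) x y‖ ≤ B := by
  have h1 : ∀ b : G, ∃ C : ℝ, ∀ ω, ‖coeff (H ω) 1 b‖ ≤ C := fun b => by
    obtain ⟨C, hC⟩ := isCompact_univ.exists_bound_of_continuousOn
      (hH.continuous_coeff 1 b).continuousOn
    exact ⟨C, fun ω => hC ω (Set.mem_univ _)⟩
  choose C hC using h1
  have hnn : ∀ b ∈ cayleyBall S M, 0 ≤ |C b| := fun b _ => abs_nonneg _
  refine ⟨∑ b ∈ cayleyBall S M, |C b|, Finset.sum_nonneg hnn, fun ω x y => ?_⟩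
  by_cases h : y * x⁻¹ ∈ (cayley S).ball 1 M
  · have h2 := hH.coeff_mul_left ω x (y * x⁻¹)
    rw [inv_mul_cancel_right] at h2
    rw [h2]
    calc _ ≤ C (y * x⁻¹) := hC _ _
      _ ≤ |C (y * x⁻¹)| := le_abs_self _
      _ ≤ _ := Finset.single_le_sum (f := fun b => |C b|) hnn (mem_cayleyBall.mpr h)
  · rw [hH.coeff_eq_zero ω h, norm_zero]
    exact Finset.sum_nonneg hnn

theorem exists_norm_bound [CompactSpace X] (hH : IsContinuousOperator S M H) :
    ∃ C : ℝ, ∀ ω, ‖H ω‖ ≤ C := by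
  classical
  obtain ⟨B, hB, hcoeff⟩ := hH.exists_coeff_bound
  refine ⟨B * (cayleyBall S M).card, fun ω => ?_⟩
  refine norm_le_of_coeff_bound (hH.selfAdjoint ω) (fun x => (cayleyBall S M).image (· * x))
    (fun x y hy => hH.coeff_eq_zero ω fun h =>
      hy (Finset.mem_image.mpr ⟨y * x⁻¹, mem_cayleyBall.mpr h, by simp⟩))
    (fun x => Finset.card_image_le) (fun y => (cayleyBall S M).image (·⁻¹ * y))
    (fun x y hy => ?_) (fun x => Finset.card_image_le) hB (hcoeff ω)
  obtain ⟨b, hb, rfl⟩ := Finset.mem_image.mp hy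
  exact Finset.mem_image.mpr ⟨b, hb, by simp⟩

theorem continuous_pow_delta (hH : IsContinuousOperator S M H) (k : ℕ) (v x : G) :
    Continuous fun ω => ((H ω) ^ k) (delta v) x := by
  induction k generalizing x with
  | zero => simpa using continuous_const
  | succ k ih =>
    have : (fun ω => ((H ω) ^ (k + 1)) (delta v) x) = fun ω =>
        ∑ b ∈ cayleyBall S M, coeff (H ω) x (b * x) * ((H ω) ^ k) (delta v) (b * x) := by
      funext ω
      rw [pow_succ_apply, hH.apply_eq]
    rw [this]
    exact continuous_finsetSum _ fun b _ => (hH.continuous_coeff _ _).mul (ih _)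

theorem pow_delta_mul (hH : IsContinuousOperator S M H) (ω : G → X) (k : ℕ) (h g x : G) :
    ((H ω) ^ k) (delta (h * g)) (x * g) = ((H (shift g ω)) ^ k) (delta h) x := by
  induction k generalizing x with
  | zero =>
    by_cases hx : x = h
    · simp [hx, delta_self]
    · have : x * g ≠ h * g := fun e => hx (mul_right_cancel e)
      simp [delta_of_ne hx, delta_of_ne this]
  | succ k ih =>
    rw [pow_succ_apply, pow_succ_apply, hH.apply_eq, hH.apply_eq]
    refine Finset.sum_congr rfl fun b _ => ?_
    rw [← mul_assoc, ih, hH.equivariant]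

/-- The norm bound is uniform in ω, so one polynomial works for all ω, and the function is a uniform
limit of continuous ones. -/
theorem continuous_diagCfc [CompactSpace X] (hH : IsContinuousOperator S M H) (f : ℝ →ᵇ ℝ)
    (v : G) : Continuous fun ω => diagCfc f (H ω) v := by
  obtain ⟨C, hC⟩ := hH.exists_norm_bound
  refine continuous_of_uniform_approx_of_continuous fun u hu => ?_
  obtain ⟨ε, hε, hεu⟩ := Metric.mem_uniformity_dist.mp hu
  obtain ⟨p, hp⟩ := exists_polynomial_near f C (half_pos hε)
  refine ⟨fun ω => (diagPoly p (H ω) v).re, ?_, fun ω => hεu ?_⟩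
  · exact Complex.continuous_re.comp (continuous_finsetSum _ fun i _ =>
      continuous_const.mul (hH.continuous_pow_delta i v v))
  · rw [Real.dist_eq]
    exact (abs_diagCfc_sub_le (hH.selfAdjoint ω) (hC ω) f (half_pos hε).le hp v).trans_lt
      (half_lt_self hε)

theorem diagCfc_eq_shift [CompactSpace X] (hH : IsContinuousOperator S M H) (f : ℝ →ᵇ ℝ)
    (ω : G → X) (g : G) : diagCfc f (H ω) g = diagCfc f (H (shift g ω)) 1 := by
  obtain ⟨C, hC⟩ := hH.exists_norm_bound
  refine eq_of_abs_sub_le_all fun ε hε => ?_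
  obtain ⟨p, hp⟩ := exists_polynomial_near f C (half_pos hε)
  have h1 := abs_diagCfc_sub_le (hH.selfAdjoint ω) (hC ω) f (half_pos hε).le hp g
  have h2 := abs_diagCfc_sub_le (hH.selfAdjoint (shift g ω)) (hC _) f (half_pos hε).le hp 1
  have h3 : diagPoly p (H ω) g = diagPoly p (H (shift g ω)) 1 := by
    refine Finset.sum_congr rfl fun i _ => ?_
    rw [← hH.pow_delta_mul, one_mul]
  rw [h3] at h1
  rw [abs_le] at *
  constructor <;> linarith [h1.1, h1.2, h2.1, h2.2]

end IsContinuousOperator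

/-- For finite G the normalized trace averages over all g; invariance of μ under the shift makes all
terms equal to the one at the identity. -/
theorem densityOfStates_eq {G X : Type*} [Group G] [Countable G]
    [MetricSpace X] [CompactSpace X] [MeasurableSpace X] [BorelSpace X] {S : Finset G} {M : ℕ}
    {H : (G → X) → Op G} (hH : IsContinuousOperator S M H) {μ : ProbabilityMeasure (G → X)}
    (hμ : IsProcess μ) (f : ℝ →ᵇ ℝ) :
    densityOfStates μ H f = ∫ ω, diagCfc f (H ω) 1 ∂(μ : Measure (G → X)) := by
  have hcont := hH.continuous_diagCfc f
  have hint : ∀ v, Integrable (fun ω => diagCfc f (H ω) v) (μ : Measure (G → X)) := fun v =>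
    Integrable.of_bound (hcont v).aestronglyMeasurable ‖f‖
      (ae_of_all _ fun ω => abs_diagCfc_le f (H ω) v)
  rw [densityOfStates]
  by_cases hG : Finite G
  · have := Fintype.ofFinite G
    have hshift : ∀ g : G, ∫ ω, diagCfc f (H ω) g ∂(μ : Measure (G → X)) =
        ∫ ω, diagCfc f (H ω) 1 ∂(μ : Measure (G → X)) := fun g => by
      simp only [hH.diagCfc_eq_shift f _ g]
      have hm := hμ g
      have := integral_map (μ := (μ : Measure (G → X))) hm.measurable.aemeasurable
        (hcont 1).aestronglyMeasurable
      rw [hm.map_eq] at this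
      exact this.symm
    simp only [groupMeasure, if_pos hG, integral_traceMeasure]
    rw [integral_const_mul, integral_finsetSum _ fun g _ => hint g]
    simp only [hshift, Finset.sum_const, nsmul_eq_mul, Finset.card_univ]
    rw [← mul_assoc, inv_mul_cancel₀ (by exact_mod_cast Fintype.card_ne_zero), one_mul]
  · simp only [groupMeasure, if_neg hG]
    exact integral_congr_ae (ae_of_all _ fun ω => (integral_spectralMeasure (H ω) (delta 1) f).2)

/-! ### Properties of almost all vertices -/

/-- The proportion of vertices of `V n` that satisfy `P n` tends to one. -/
def AlmostAll {V : ℕ → Type*} (P : ∀ n, V n → Prop) : Prop :=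
  Tendsto (fun n => (({v : V n | P n v}.ncard : ℝ) / (Nat.card (V n) : ℝ))) atTop (𝓝 1)

namespace AlmostAll

variable {V : ℕ → Type*} [∀ n, Finite (V n)] {P Q : ∀ n, V n → Prop}

theorem ratio_le_one {V : Type*} [Finite V] (s : Set V) :
    (s.ncard : ℝ) / (Nat.card V : ℝ) ≤ 1 :=
  div_le_one_of_le₀ (by exact_mod_cast Set.ncard_le_card s) (Nat.cast_nonneg _)

theorem mono (hP : AlmostAll P) (h : ∀ n v, P n v → Q n v) : AlmostAll Q := by
  refine tendsto_of_tendsto_of_tendsto_of_le_of_le hP tendsto_const_nhds (fun n => ?_)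
    fun n => ratio_le_one _
  change _ / _ ≤ _ / _
  gcongr
  · exact Set.toFinite _
  · exact h n _

theorem and (hP : AlmostAll P) (hQ : AlmostAll Q) : AlmostAll fun n v => P n v ∧ Q n v := by
  have h : Tendsto (fun n => (({v : V n | P n v}.ncard : ℝ) / (Nat.card (V n) : ℝ)) +
      (({v : V n | Q n v}.ncard : ℝ) / (Nat.card (V n) : ℝ)) - 1) atTop (𝓝 1) := by
    have := (hP.add hQ).sub_const 1
    simpa using this
  refine tendsto_of_tendsto_of_tendsto_of_le_of_le h tendsto_const_nhds (fun n => ?_)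
    fun n => ratio_le_one _
  change _ + _ - 1 ≤ _ / _
  -- For empty V n all ratios are 0/0 = 0, and the claim reads -1 ≤ 0.
  rcases (Nat.cast_nonneg (α := ℝ) (Nat.card (V n))).eq_or_lt with h0 | h0
  · simp [← h0]
  · have h1 := Set.ncard_union_add_ncard_inter {v : V n | P n v} {v : V n | Q n v}
    have h2 := Set.ncard_le_card ({v : V n | P n v} ∪ {v : V n | Q n v})
    have h3 : ({v : V n | P n v} ∩ {v : V n | Q n v}) = {v | P n v ∧ Q n v} := rfl
    rw [h3] at h1
    have h4 : (({v : V n | P n v}.ncard : ℝ) + {v : V n | Q n v}.ncard) ≤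
        Nat.card (V n) + {v : V n | P n v ∧ Q n v}.ncard := by
      exact_mod_cast h1 ▸ Nat.add_le_add_right h2 _
    rw [← add_div, sub_le_iff_le_add, div_add_one h0.ne']
    exact div_le_div_of_nonneg_right (h4.trans_eq (add_comm _ _)) h0.le

/-- The auxiliary property Q covers empty F: even the always true property has ratio 0 when V n is
empty. -/
theorem finset_forall {ι : Type*} (F : Finset ι) {P : ι → ∀ n, V n → Prop}
    (hQ : AlmostAll Q) (hP : ∀ i ∈ F, AlmostAll (P i)) :
    AlmostAll fun n v => ∀ i ∈ F, P i n v := by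
  classical
  induction F using Finset.induction_on with
  | empty => exact hQ.mono fun n v _ => by simp
  | insert a F _ ih =>
    refine ((hP a (Finset.mem_insert_self a F)).and
      (ih fun i hi => hP i (Finset.mem_insert_of_mem hi))).mono fun n v h i hi => ?_
    rcases Finset.mem_insert.mp hi with rfl | hi
    · exact h.1
    · exact h.2 i hi

end AlmostAll

theorem AlmostAll.perm {V : ℕ → Type*} {P : ∀ n, V n → Prop} (hP : AlmostAll P)
    (τ : ∀ n, Equiv.Perm (V n)) :
    AlmostAll fun n v => P n (τ n v) := by
  refine Tendsto.congr (fun n => ?_) hP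
  have : {v : V n | P n v} = τ n '' {v : V n | P n (τ n v)} := by
    ext v
    constructor
    · intro hv
      exact ⟨(τ n).symm v, by simpa using hv, by simp⟩
    · rintro ⟨w, hw, rfl⟩
      exact hw
  rw [this, Set.ncard_image_of_injective _ (τ n).injective]

/-! ### Good vertices -/

section Good

variable {G V : Type*} [Group G] {S : Finset G} {σ : G → Equiv.Perm V}

theorem apply_one_of_mul {w : V} (h : σ 1 (σ 1 w) = σ (1 * 1) w) : σ 1 w = w := by
  rw [one_mul] at h
  exact (σ 1).injective h

/-- The map g ↦ σ g w identifies the balls. Deciding whether s * g = h needs injectivity on radius R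
+ 1, where quotients h⁻¹ * g have length at most 2R + 2. -/
theorem isGood_of_local (hS : IsSymmGenerating S) {R : ℕ} {w : V}
    (hmul : ∀ g ∈ (cayley S).ball 1 (2 * R + 2), ∀ h ∈ (cayley S).ball 1 (2 * R + 2),
      σ g (σ h w) = σ (g * h) w)
    (hfree : ∀ g ∈ (cayley S).ball 1 (2 * R + 2), g ≠ 1 → σ g w ≠ w) :
    IsGood S σ R w := by
  classical
  have hmono : ∀ {q r : ℕ} {g : G}, q ≤ r → g ∈ (cayley S).ball 1 q → g ∈ (cayley S).ball 1 r :=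
    fun h hg => LabelledGraph.ball_mono _ _ h hg
  have hone : σ 1 w = w :=
    apply_one_of_mul (hmul 1 (one_mem_cayley_ball S _) 1 (one_mem_cayley_ball S _))
  have hinj : ∀ g ∈ (cayley S).ball 1 (R + 1), ∀ h ∈ (cayley S).ball 1 (R + 1),
      σ g w = σ h w → g = h := by
    intro g hg h hh e
    by_contra hne
    have hk : h⁻¹ * g ∈ (cayley S).ball 1 (2 * R + 2) :=
      hmono (by omega) (mul_mem_cayley_ball hS (inv_mem_cayley_ball hS hh) hg)
    refine hfree _ hk (fun h1 => hne (inv_mul_eq_one.mp h1).symm) ((σ h).injective ?_)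
    rw [hmul h (hmono (by omega) hh) _ hk, mul_inv_cancel_left, e]
  have hstep : ∀ s ∈ S, ∀ g ∈ (cayley S).ball 1 R, ∀ h ∈ (cayley S).ball 1 R,
      (σ s (σ g w) = σ h w ↔ s * g = h) := by
    intro s hs g hg h hh
    have hsg : s * g ∈ (cayley S).ball 1 (R + 1) :=
      hmono (by omega) (mul_mem_cayley_ball hS (mem_cayley_ball_one hS hs) hg)
    rw [hmul s (hmono (by omega) (mem_cayley_ball_one hS hs)) g (hmono (by omega) hg)]
    exact ⟨hinj _ hsg _ (hmono (by omega) hh), fun e => by rw [e]⟩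
  have hball : ∀ r ≤ R, ∀ x, x ∈ (soficGraph S σ).ball w r ↔
      ∃ g ∈ (cayley S).ball 1 r, σ g w = x := by
    intro r
    induction r with
    | zero =>
      intro _ x
      simp only [LabelledGraph.mem_ball_zero, exists_eq_left, hone, eq_comm]
    | succ r ih =>
      intro hr x
      have ih := ih (by omega)
      rw [LabelledGraph.mem_ball_succ]
      constructor
      · rintro (hx | ⟨y, hy, hadj⟩)
        · obtain ⟨g, hg, rfl⟩ := (ih x).mp hx
          exact ⟨g, hmono (by omega) hg, rfl⟩
        · obtain ⟨g, hg, rfl⟩ := (ih y).mp hy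
          rcases (soficGraph_adj.mp hadj).2 with ⟨s, hs, h⟩ | ⟨s, hs, h⟩
          · refine ⟨s * g, hmono (by omega) (mul_mem_cayley_ball hS (mem_cayley_ball_one hS hs) hg),
              ?_⟩
            rw [← h, hmul s (hmono (by omega) (mem_cayley_ball_one hS hs)) g (hmono (by omega) hg)]
          -- This edge points back towards the smaller ball; σ s⁻¹ is not assumed inverse to σ s, so
          -- the points are compared after applying σ s.
          · have hsg := mul_mem_cayley_ball hS (mem_cayley_ball_one hS (hS.inv_mem s hs)) hg
            refine ⟨s⁻¹ * g, hmono (by omega) hsg, (σ s).injective ?_⟩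
            rw [h, hmul s (hmono (by omega) (mem_cayley_ball_one hS hs)) _ (hmono (by omega) hsg),
              mul_inv_cancel_left]
      · rintro ⟨g, hg, rfl⟩
        rcases (mem_cayley_ball_succ hS).mp hg with hg | ⟨s, hs, h, hh, rfl⟩
        · exact Or.inl ((ih _).mpr ⟨g, hg, rfl⟩)
        · rw [← hmul s (hmono (by omega) (mem_cayley_ball_one hS hs)) h (hmono (by omega) hh)]
          have hy := (ih (σ h w)).mpr ⟨h, hh, rfl⟩
          by_cases he : σ h w = σ s (σ h w)
          · exact Or.inl (he ▸ hy)
          · exact Or.inr ⟨_, hy, soficGraph_adj.mpr ⟨he, Or.inl ⟨s, hs, rfl⟩⟩⟩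
  have hchoose : ∀ x, ∃ g, x ∈ (soficGraph S σ).ball w R →
      g ∈ (cayley S).ball 1 R ∧ σ g w = x := fun x => by
    by_cases hx : x ∈ (soficGraph S σ).ball w R
    · obtain ⟨g, hg⟩ := (hball R le_rfl x).mp hx
      exact ⟨g, fun _ => hg⟩
    · exact ⟨1, fun h => (hx h).elim⟩
  choose φ hφ using hchoose
  have hφσ : ∀ g ∈ (cayley S).ball 1 R, φ (σ g w) = g := fun g hg => by
    have := hφ (σ g w) ((hball R le_rfl _).mpr ⟨g, hg, rfl⟩)
    exact hinj _ (hmono (by omega) this.1) _ (hmono (by omega) hg) this.2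
  refine ⟨φ, ⟨?_, ⟨fun x hx => (hφ x hx).1, fun x hx y hy e => ?_, fun g hg => ?_⟩, ?_, ?_⟩,
    fun x hx => (hφ x hx).2⟩
  · have := hφσ 1 (one_mem_cayley_ball S R)
    rwa [hone] at this
  · rw [← (hφ x hx).2, ← (hφ y hy).2, e]
  · exact ⟨σ g w, (hball R le_rfl _).mpr ⟨g, hg, rfl⟩, hφσ g hg⟩
  · intro x hx y hy
    obtain ⟨g, hg, rfl⟩ := (hball R le_rfl x).mp hx
    obtain ⟨h, hh, rfl⟩ := (hball R le_rfl y).mp hy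
    rw [hφσ g hg, hφσ h hh, soficGraph_adj, cayley_adj]
    refine and_congr (not_congr ⟨hinj g (hmono (by omega) hg) h (hmono (by omega) hh),
      fun e => by rw [e]⟩) (or_congr ?_ ?_)
    · exact exists_congr fun s => and_congr_right fun hs => hstep s hs g hg h hh
    · exact exists_congr fun s => and_congr_right fun hs => hstep s hs h hh g hg
  · intro x hx y hy s
    obtain ⟨g, hg, rfl⟩ := (hball R le_rfl x).mp hx
    obtain ⟨h, hh, rfl⟩ := (hball R le_rfl y).mp hy
    rw [hφσ g hg, hφσ h hh]
    exact and_congr_right fun hs => hstep s hs g hg h hh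

theorem IsGood.apply_mem_ball {R : ℕ} {w : V} (hw : IsGood S σ R w) {g : G}
    (hg : g ∈ (cayley S).ball 1 R) : σ g w ∈ (soficGraph S σ).ball w R := by
  obtain ⟨φ, hφ, hσ⟩ := hw
  obtain ⟨x, hx, rfl⟩ := hφ.bijOn.surjOn hg
  rwa [hσ x hx]

theorem IsGood.injOn {R : ℕ} {w : V} (hw : IsGood S σ R w) :
    Set.InjOn (fun g => σ g w) ((cayley S).ball 1 R) := by
  obtain ⟨φ, hφ, hσ⟩ := hw
  intro g hg h hh e
  obtain ⟨x, hx, rfl⟩ := hφ.bijOn.surjOn hg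
  obtain ⟨y, hy, rfl⟩ := hφ.bijOn.surjOn hh
  have e : σ (φ x) w = σ (φ y) w := e
  rw [hσ x hx, hσ y hy] at e
  rw [e]

theorem IsGood.exists_apply_eq {R : ℕ} {w : V} (hw : IsGood S σ R w) {x : V}
    (hx : x ∈ (soficGraph S σ).ball w R) : ∃ g ∈ (cayley S).ball 1 R, σ g w = x := by
  obtain ⟨φ, hφ, hσ⟩ := hw
  exact ⟨φ x, hφ.bijOn.mapsTo hx, hσ x hx⟩

/-- At a good vertex the row is indexed by group elements, in the same form as the row of the limit
operator in `IsContinuousOperator.apply_eq`. -/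
theorem apply_eq_sum_of_isGood {T : Op V} (hT : IsSelfAdjoint T) {M : ℕ}
    (hM : HasHoppingRange (soficGraph S σ) M T) {w : V} (hw : IsGood S σ M w) (u : ell2 V) :
    T u w = ∑ b ∈ cayleyBall S M, coeff T w (σ b w) * u (σ b w) := by
  classical
  rw [apply_eq_sum hT (x := w) (N := (cayleyBall S M).image fun b => σ b w)]
  · exact Finset.sum_image fun a ha b hb h =>
      hw.injOn (mem_cayleyBall.mp ha) (mem_cayleyBall.mp hb) h
  · intro y hy
    refine hM w y fun h => hy ?_
    obtain ⟨g, hg, rfl⟩ := hw.exists_apply_eq h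
    exact Finset.mem_image_of_mem _ (mem_cayleyBall.mpr hg)

end Good

section Sofic

variable {G : Type*} [Group G] {V : ℕ → Type*} [∀ n, Finite (V n)] {σ : ∀ n, G → Equiv.Perm (V n)}

theorem IsSoficApproximation.almostAll_mul (hσ : IsSoficApproximation σ) (F F' : Finset G) :
    AlmostAll fun n v => ∀ g ∈ F, ∀ h ∈ F', σ n g (σ n h v) = σ n (g * h) v :=
  .finset_forall F (hσ.mul 1 1) fun g _ => .finset_forall F' (hσ.mul 1 1) fun h _ => hσ.mul g h

theorem IsSoficApproximation.almostAll_free (hσ : IsSoficApproximation σ) (F : Finset G) :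
    AlmostAll fun n v => ∀ g ∈ F, g ≠ 1 → σ n g v ≠ v := by
  refine .finset_forall F (hσ.mul 1 1) fun g _ => ?_
  by_cases hg : g = 1
  · exact AlmostAll.mono (hσ.mul 1 1) fun n v _ h => (h hg).elim
  · exact AlmostAll.mono (hσ.free g hg) fun n v h _ => h

theorem IsSoficApproximation.almostAll_isGood (hσ : IsSoficApproximation σ) {S : Finset G}
    (hS : IsSymmGenerating S) (R : ℕ) : AlmostAll fun n v => IsGood S (σ n) R v := by
  refine ((hσ.almostAll_mul (cayleyBall S (2 * R + 2)) (cayleyBall S (2 * R + 2))).and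
    (hσ.almostAll_free (cayleyBall S (2 * R + 2)))).mono fun n v h => isGood_of_local hS ?_ ?_
  · exact fun g hg k hk => h.1 g (mem_cayleyBall.mpr hg) k (mem_cayleyBall.mpr hk)
  · exact fun g hg => h.2 g (mem_cayleyBall.mpr hg)

end Sofic

/-! ### Comparison of the approximations with the limit operators -/

/-- Induction on j: a value at σ g v after one more application of T uses the previous values at
distance up to M. The region of agreement thus shrinks by M per step, and at j = k still contains
the identity. -/
theorem pow_delta_eq_of_local {G X V : Type*} [Group G] [TopologicalSpace X]
    {S : Finset G} (hS : IsSymmGenerating S) {M : ℕ} {H : (G → X) → Op G}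
    (hH : IsContinuousOperator S M H) {σ : G → Equiv.Perm V} {T : Op V} (hT : IsSelfAdjoint T)
    (hM : HasHoppingRange (soficGraph S σ) M T) {v : V} {ω : G → X} {k : ℕ}
    (hgood : ∀ g ∈ (cayley S).ball 1 (k * M), IsGood S σ M (σ g v))
    (hmul : ∀ b ∈ (cayley S).ball 1 M, ∀ g ∈ (cayley S).ball 1 (k * M),
      σ b (σ g v) = σ (b * g) v)
    (hone : σ 1 v = v)
    (hfree : ∀ g ∈ (cayley S).ball 1 (k * M), g ≠ 1 → σ g v ≠ v)
    (hcoeff : ∀ g ∈ (cayley S).ball 1 (k * M), ∀ b ∈ (cayley S).ball 1 M,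
      coeff T (σ g v) (σ b (σ g v)) = coeff (H ω) g (b * g))
    {j : ℕ} (hj : j ≤ k) {g : G} (hg : g ∈ (cayley S).ball 1 ((k - j) * M)) :
    (T ^ j) (delta v) (σ g v) = ((H ω) ^ j) (delta 1) g := by
  induction j generalizing g with
  | zero =>
    by_cases h : g = 1
    · subst h
      simp [hone, delta_self]
    · simp [delta_of_ne h, delta_of_ne (hfree g hg h)]
  | succ j ih =>
    have hg' : g ∈ (cayley S).ball 1 (k * M) :=
      LabelledGraph.ball_mono _ _ (Nat.mul_le_mul_right M (Nat.sub_le _ _)) hg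
    rw [pow_succ_apply, pow_succ_apply, apply_eq_sum_of_isGood hT hM (hgood g hg'), hH.apply_eq]
    refine Finset.sum_congr rfl fun b hb => ?_
    rw [mem_cayleyBall] at hb
    rw [hcoeff g hg' b hb, hmul b hb g hg', ih (by omega)]
    have := mul_mem_cayley_ball hS hb hg
    rwa [show M + (k - (j + 1)) * M = (k - j) * M by
      rw [show k - j = k - (j + 1) + 1 by omega]; ring] at this

section Approximation

variable {G X : Type*} [Group G] [TopologicalSpace X] [MeasurableSpace X]
  {S : Finset G} {V : ℕ → Type*} {σ : ∀ n, G → Equiv.Perm (V n)}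
  {M : ℕ} {H : (G → X) → Op G} {Hn : ∀ n, (V n → X) → Op (V n)}

/-- The condition `coeff_mem` controls the coefficients at bad vertices too, so the Schur test is
uniform in n and ρ. -/
theorem IsInducedApproximation.exists_norm_bound [CompactSpace X]
    (hHn : IsInducedApproximation S σ M H Hn)
    (hH : IsContinuousOperator S M H) : ∃ C : ℝ, ∀ n ρ, ‖Hn n ρ‖ ≤ C := by
  classical
  obtain ⟨B, hB, hcoeff⟩ := hH.exists_coeff_bound
  refine ⟨B * ((S.card + S.card + 1) ^ M : ℕ), fun n ρ => ?_⟩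
  choose N hN hcard using exists_soficGraph_ball_subset S (σ n) M
  -- Cutting down to the exact ball makes membership symmetric, so one family serves rows and
  -- columns.
  have hcard' : ∀ x, ((N x).filter (· ∈ (soficGraph S (σ n)).ball x M)).card ≤
      (S.card + S.card + 1) ^ M := fun x => (Finset.card_filter_le _ _).trans (hcard x)
  refine norm_le_of_coeff_bound (hHn.selfAdjoint n ρ)
    (fun x => (N x).filter (· ∈ (soficGraph S (σ n)).ball x M)) (fun x y hy => ?_) hcard'
    (fun x => (N x).filter (· ∈ (soficGraph S (σ n)).ball x M)) (fun x y hy => ?_) hcard'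
    hB (fun x y => ?_)
  · exact hHn.hopping n ρ x y fun h => hy (Finset.mem_filter.mpr ⟨hN x h, h⟩)
  · have h := (LabelledGraph.mem_ball_comm _).mp (Finset.mem_filter.mp hy).2
    exact Finset.mem_filter.mpr ⟨hN y h, h⟩
  · rcases hHn.coeff_mem n ρ x y with ⟨a, b, ω, h⟩ | h
    · rw [h]
      exact hcoeff ω a b
    · rw [Set.mem_singleton_iff.mp h, norm_zero]
      exact hB

/-- The lift at σ g v should be the shift by g of the lift at v. For homomorphisms this is exact;
otherwise it holds on any prescribed finite ball for almost all v, which bounded interaction makes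
sufficient. -/
theorem almostAll_coeff_eq [∀ n, Finite (V n)] (hS : IsSymmGenerating S)
    (hσ : IsSoficApproximation σ) (hH : IsContinuousOperator S M H)
    (hor : (∀ n g h, σ n (g * h) = σ n g * σ n h) ∨ ∃ K : ℕ, HasBoundedInteraction S K H)
    (hHn : IsWeakApproximation S σ M H Hn) (F : Finset G) :
    AlmostAll fun n v => ∀ g ∈ F, ∀ b ∈ (cayley S).ball 1 M, ∀ ρ : V n → X,
      coeff (Hn n ρ) (σ n g v) (σ n b (σ n g v)) = coeff (H (lift (σ n) v ρ)) g (b * g) := by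
  have hgood := hσ.almostAll_isGood hS
  have hlocal : AlmostAll fun n v => ∀ g ∈ F,
      IsGood S (σ n) M (σ n g v) ∧ IsGood S (σ n) (4 * M) (σ n g v) :=
    .finset_forall F (hgood M) fun g _ => ((hgood M).and (hgood (4 * M))).perm fun n => σ n g
  have hshift : AlmostAll fun n v => ∀ g ∈ F, ∀ b : G, ∀ ρ : V n → X,
      coeff (H (lift (σ n) (σ n g v) ρ)) 1 b = coeff (H (shift g (lift (σ n) v ρ))) 1 b := by
    rcases hor with hhom | ⟨K, hK⟩
    -- The identity holds at every v; goodness only supplies a family of vertex sets with proportion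
    -- tending to one.
    · refine (hgood M).mono fun n v _ g _ b ρ => ?_
      have : lift (σ n) (σ n g v) ρ = shift g (lift (σ n) v ρ) := by
        funext h
        simp [lift, shift, hhom]
      rw [this]
    · refine (hσ.almostAll_mul (cayleyBall S K) F).mono fun n v h g hg b ρ => hK _ _ ?_ b
      intro a ha
      simp only [lift, shift]
      rw [h a (mem_cayleyBall.mpr ha) g hg]
  refine (hlocal.and hshift).mono fun n v h g hg b hb ρ => ?_
  rw [hHn.coeff_eq n _ (h.1 g hg).2 ρ _ ((h.1 g hg).1.apply_mem_ball hb) b hb rfl,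
    h.2 g hg b ρ, hH.coeff_mul_left]

theorem almostAll_pow_delta_eq [∀ n, Finite (V n)] (hS : IsSymmGenerating S)
    (hσ : IsSoficApproximation σ) (hH : IsContinuousOperator S M H)
    (hor : (∀ n g h, σ n (g * h) = σ n g * σ n h) ∨ ∃ K : ℕ, HasBoundedInteraction S K H)
    (hHn : IsWeakApproximation S σ M H Hn) (k : ℕ) :
    AlmostAll fun n v => ∀ j ≤ k, ∀ ρ : V n → X,
      ((Hn n ρ) ^ j) (delta v) v = ((H (lift (σ n) v ρ)) ^ j) (delta 1) 1 := by
  let F := cayleyBall S (k * M)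
  have hgood : AlmostAll fun n v => ∀ g ∈ F, IsGood S (σ n) M (σ n g v) :=
    .finset_forall F (hσ.almostAll_isGood hS M) fun g _ =>
      (hσ.almostAll_isGood hS M).perm fun n => σ n g
  refine (((hgood.and (hσ.almostAll_mul (cayleyBall S M) F)).and (hσ.almostAll_free F)).and
    (almostAll_coeff_eq hS hσ hH hor hHn F)).mono fun n v h j hj ρ => ?_
  obtain ⟨⟨⟨h1, h2⟩, h3⟩, h4⟩ := h
  have hone : σ n 1 v = v := apply_one_of_mul (h2 1 (mem_cayleyBall.mpr (one_mem_cayley_ball S _)) 1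
    (mem_cayleyBall.mpr (one_mem_cayley_ball S _)))
  have := pow_delta_eq_of_local hS hH (hHn.selfAdjoint n ρ) (hHn.hopping n ρ) (v := v)
    (ω := lift (σ n) v ρ) (k := k) (fun g hg => h1 g (mem_cayleyBall.mpr hg))
    (fun b hb g hg => h2 b (mem_cayleyBall.mpr hb) g (mem_cayleyBall.mpr hg)) hone
    (fun g hg => h3 g (mem_cayleyBall.mpr hg))
    (fun g hg b hb => h4 g (mem_cayleyBall.mpr hg) b hb ρ) hj
    (one_mem_cayley_ball S _)
  rwa [hone] at this

theorem almostAll_diagCfc_near [CompactSpace X] [∀ n, Finite (V n)] (hS : IsSymmGenerating S)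
    (hσ : IsSoficApproximation σ) (hH : IsContinuousOperator S M H)
    (hor : (∀ n g h, σ n (g * h) = σ n g * σ n h) ∨ ∃ K : ℕ, HasBoundedInteraction S K H)
    (hHn : IsInducedApproximation S σ M H Hn) (f : ℝ →ᵇ ℝ) {η : ℝ} (hη : 0 < η) :
    AlmostAll fun n v => ∀ ρ : V n → X,
      |diagCfc f (Hn n ρ) v - diagCfc f (H (lift (σ n) v ρ)) 1| ≤ η := by
  obtain ⟨C₁, hC₁⟩ := hH.exists_norm_bound
  obtain ⟨C₂, hC₂⟩ := hHn.exists_norm_bound hH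
  -- One polynomial serves both families; its degree fixes how many powers must agree, hence the set
  -- of vertices, independently of ρ.
  obtain ⟨p, hp⟩ := exists_polynomial_near f (max C₁ C₂) (half_pos hη)
  refine (almostAll_pow_delta_eq hS hσ hH hor hHn.toIsWeakApproximation p.natDegree).mono
    fun n v h ρ => ?_
  have h1 := abs_diagCfc_sub_le (hHn.selfAdjoint n ρ) ((hC₂ n ρ).trans (le_max_right C₁ C₂))
    f (half_pos hη).le hp v
  have h2 := abs_diagCfc_sub_le (hH.selfAdjoint (lift (σ n) v ρ))
    ((hC₁ _).trans (le_max_left C₁ C₂)) f (half_pos hη).le hp 1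
  have h3 : diagPoly p (Hn n ρ) v = diagPoly p (H (lift (σ n) v ρ)) 1 := by
    refine Finset.sum_congr rfl fun i hi => ?_
    rw [h i (Nat.lt_succ_iff.mp (Finset.mem_range.mp hi)) ρ]
  rw [h3] at h1
  rw [abs_le] at *
  constructor <;> linarith [h1.1, h1.2, h2.1, h2.2]

end Approximation

/-- The average of a function that is bounded by `A` everywhere and by `η` on `s`. -/
theorem abs_average_le {V : Type*} [Fintype V] [Nonempty V] {a : V → ℝ} {s : Set V} {η A : ℝ}
    (hη : 0 ≤ η) (hs : ∀ v ∈ s, |a v| ≤ η) (hA : ∀ v, |a v| ≤ A) :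
    |(Fintype.card V : ℝ)⁻¹ * ∑ v, a v| ≤ η + A * (1 - s.ncard / Nat.card V) := by
  classical
  have hV : (0 : ℝ) < Fintype.card V := by exact_mod_cast Fintype.card_pos
  have h1 : ∑ v, |a v| ≤ ∑ v, (η + A * (1 - if v ∈ s then 1 else 0)) := by
    refine Finset.sum_le_sum fun v _ => ?_
    by_cases hv : v ∈ s
    · simpa [hv] using hs v hv
    · simpa [hv] using (hA v).trans (le_add_of_nonneg_left hη)
  have h2 : ∑ v, (η + A * (1 - if v ∈ s then (1 : ℝ) else 0)) =
      Fintype.card V * (η + A * (1 - s.ncard / Nat.card V)) := by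
    rw [Finset.sum_add_distrib, ← Finset.mul_sum, Finset.sum_sub_distrib]
    simp only [Finset.sum_const, Finset.card_univ, nsmul_eq_mul, mul_one, Finset.sum_boole,
      Nat.card_eq_fintype_card]
    rw [Set.ncard_eq_toFinset_card', show s.toFinset = Finset.univ.filter (· ∈ s) by ext; simp]
    field_simp
  rw [abs_mul, abs_of_pos (inv_pos.mpr hV), inv_mul_le_iff₀ hV, ← h2]
  exact (Finset.abs_sum_le_sum_abs _ _).trans h1

/-- Exceptional vertices contribute at most 2‖f‖ each and their proportion tends to zero; they do
not depend on ρ, so the threshold for n does not either. -/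
theorem eventually_average_near {G X : Type*} [Group G]
    [TopologicalSpace X] [CompactSpace X] [MeasurableSpace X]
    {S : Finset G} {V : ℕ → Type*} {σ : ∀ n, G → Equiv.Perm (V n)}
    {M : ℕ} {H : (G → X) → Op G} {Hn : ∀ n, (V n → X) → Op (V n)} [∀ n, Fintype (V n)]
    (hS : IsSymmGenerating S) (hσ : IsSoficApproximation σ) (hH : IsContinuousOperator S M H)
    (hor : (∀ n g h, σ n (g * h) = σ n g * σ n h) ∨ ∃ K : ℕ, HasBoundedInteraction S K H)
    (hHn : IsInducedApproximation S σ M H Hn) (f : ℝ →ᵇ ℝ) {η : ℝ} (hη : 0 < η) :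
    ∀ᶠ n in atTop, ∀ ρ : V n → X, |(Fintype.card (V n) : ℝ)⁻¹ *
      ∑ v, (diagCfc f (Hn n ρ) v - diagCfc f (H (lift (σ n) v ρ)) 1)| < η := by
  have hall := almostAll_diagCfc_near hS hσ hH hor hHn f (half_pos hη)
  have hlim := ((hall.const_sub 1).const_mul (‖f‖ + ‖f‖)).const_add (η / 2)
  rw [sub_self, mul_zero, add_zero] at hlim
  filter_upwards [hlim.eventually_lt_const (half_lt_self hη),
    hall.eventually_const_lt zero_lt_one] with n hn hpos ρ
  -- A positive proportion excludes empty V n, where the ratio is 0.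
  have : Nonempty (V n) := by
    by_contra hemp
    rw [not_nonempty_iff] at hemp
    simp at hpos
  refine (abs_average_le (half_pos hη).le (s := {v | ∀ ρ : V n → X,
    |diagCfc f (Hn n ρ) v - diagCfc f (H (lift (σ n) v ρ)) 1| ≤ η / 2})
    (fun v hv => hv ρ) fun v => ?_).trans_lt hn
  exact (abs_sub _ _).trans (add_le_add (abs_diagCfc_le f _ _) (abs_diagCfc_le f _ _))

end SoficSpectral

end

/-! ### Conclusion from empirical convergence -/

theorem theorem5p9 {G X : Type*} [Group G] [Countable G]
    [MetricSpace X] [CompactSpace X] [MeasurableSpace X] [BorelSpace X]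
    (S : Finset G) (hS : SoficSpectral.IsSymmGenerating S)
    {V : ℕ → Type*} [∀ n, Finite (V n)]
    (σ : ∀ n, G → Equiv.Perm (V n))
    (μn : ∀ n, ProbabilityMeasure (V n → X)) (μ : ProbabilityMeasure (G → X))
    (hmodel : SoficSpectral.IsErgodicallySoficModel σ μn μ)
    (M : ℕ) (H : (G → X) → SoficSpectral.Op G)
    (hH : SoficSpectral.IsContinuousOperator S M H)
    (hor : (∀ n g h, σ n (g * h) = σ n g * σ n h) ∨
      ∃ K : ℕ, SoficSpectral.HasBoundedInteraction S K H)
    (Hn : ∀ n, (V n → X) → SoficSpectral.Op (V n))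
    (hHn : SoficSpectral.IsInducedApproximation S σ M H Hn)
    (ε : ℝ) (hε : 0 < ε) (f : ℝ →ᵇ ℝ) :
    Tendsto
      (fun n => (μn n : Measure (V n → X))
        {ρ | |(∫ s, f s ∂(SoficSpectral.traceMeasure (Hn n ρ))) -
          SoficSpectral.densityOfStates μ H f| < ε})
      atTop (𝓝 1) := by
  have := fun n => Fintype.ofFinite (V n)
  have hcont := hH.continuous_diagCfc f 1
  let φ : (G → X) →ᵇ ℝ := BoundedContinuousFunction.mkOfCompact ⟨_, hcont⟩
  have hφ : ∀ ω, φ ω = SoficSpectral.diagCfc f (H ω) 1 := fun _ => rfl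
  let O : Set (ProbabilityMeasure (G → X)) :=
    {P | |∫ ω, φ ω ∂(P : Measure (G → X)) - ∫ ω, φ ω ∂(μ : Measure (G → X))| < ε / 2}
  have hO : IsOpen O := isOpen_lt
    ((ProbabilityMeasure.continuous_integral_boundedContinuousFunction φ).sub
      continuous_const).abs continuous_const
  have hμO : μ ∈ O := by simpa [O] using half_pos hε
  -- For large n the event that the empirical distribution lies in O is contained in the target
  -- event: ε/2 is spent on the trace and ε/2 on the integral of φ.
  refine tendsto_of_tendsto_of_tendsto_of_le_of_le' (hmodel.empirical_tendsto O hO hμO)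
    tendsto_const_nhds ?_ (Eventually.of_forall fun n => prob_le_one)
  filter_upwards [SoficSpectral.eventually_average_near hS hmodel.sofic hH hor hHn f
    (half_pos hε)] with n hn
  refine measure_mono fun ρ hρ => ?_
  obtain ⟨P, hP, hPρ⟩ := hρ
  have hP : |∫ ω, φ ω ∂(P : Measure (G → X)) - ∫ ω, φ ω ∂(μ : Measure (G → X))| < ε / 2 := hP
  have h1 := hn ρ
  rw [hPρ, SoficSpectral.integral_empirical _ _ φ.continuous.stronglyMeasurable] at hP
  simp only [hφ] at hP
  rw [Finset.sum_sub_distrib, mul_sub] at h1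
  rw [Set.mem_ofPred_eq, SoficSpectral.integral_traceMeasure,
    SoficSpectral.densityOfStates_eq hH hmodel.process f]
  rw [abs_lt] at *
  constructor <;> linarith [h1.1, h1.2, hP.1, hP.2]
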